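/- Let $\mathbb F_q$ be a finite field with $q$ elements, let $m,\ell\ge 1$ be integers that are both coprime to $q$, and let $R=\mathbb F_q[x]/\langle x^m-1\rangle$. A 2D cyclic code is an $R$-submodule $C\subseteq R^\ell$ that is closed under the cyclic shift of the $\ell$ coordinates; through the coefficients of the polynomials it is also an $\mathbb F_q$-linear code of length $m\ell$. A linear code $D$ is called LCD if $D\cap D^{\perp}=\{0\}$, where $D^\perp$ is the Euclidean dual. For a polynomial $f$ with constant coefficient $f_0\neq 0$ write $f^*(x)=f_0^{-1}x^{\deg f}f(x^{-1})$. Let $$x^m-1=g_1\cdots g_s\,h_1h_1^*\cdots h_th_t^*$$ be a factorization into irreducible polynomials in $\mathbb F_q[x]$ with $g_i=g_i^*$ for all $i$. Let $\xi$ be a primitive $m$-th root of unity in an extension of $\mathbb F_q$, and choose exponents with $g_i(\xi^{u_i})=0$ and $h_j(\xi^{v_j})=0$. Put $G_i=\mathbb F_q(\xi^{u_i})$, $H_j'=\mathbb F_q(\xi^{v_j})$ and $H_j''=\mathbb F_q(\xi^{-v_j})$, so that $H_j'=H_j''$. The constituents of $C$ are the codes $$C_i\subseteq G_i^\ell,\qquad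 C_j'\subseteq (H_j')^\ell,\qquad C_j''\subseteq (H_j'')^\ell$$ spanned, over the respective field, by the vectors $(c_1(\beta),\dots,c_\ell(\beta))$ with $(c_1(x),\dots,c_\ell(x))\in C$, where $\beta=\xi^{u_i}$, $\beta=\xi^{v_j}$ and $\beta=\xi^{-v_j}$, respectively. A code $D$ of length $\ell$ is reversible if $(c_0,\dots,c_{\ell-1})\in D$ implies $(c_{\ell-1},\dots,c_0)\in D$. A code $D\subseteq G_i^\ell$ is conjugate-reversible if $(c_0,\dots,c_{\ell-1})\in D$ implies $(\bar c_{\ell-1},\dots,\bar c_0)\in D$. Here $\bar y=y^{\sqrt Q}$ with $Q=|G_i|=q^{\deg g_i}$ if $\deg g_i$ is even, and $\bar y=y$ if $\deg g_i=1$ (no other degrees occur). Suppose that $C_i$ is conjugate-reversible for every $1\le i\le s$, and that $C_j'=C_j''$ and this code is reversible for every $1\le j\le t$. Then $C$, viewed as an $\mathbb F_q$-linear code of length $m\ell$, is LCD. -/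

import Mathlib

open Polynomial

noncomputable section

/-- The Euclidean dual of a linear code `D` whose coordinates are indexed by `ι`. -/
def euclideanDual {A ι : Type*} [CommRing A] [Fintype ι] (D : Submodule A (ι → A)) :
    Submodule A (ι → A) where
  carrier := {x | ∀ d ∈ D, ∑ i, x i * d i = 0}
  add_mem' := by
    intro x y hx hy d hd
    simp only [Pi.add_apply, add_mul, Finset.sum_add_distrib, hx d hd, hy d hd, add_zero]
  zero_mem' := by
    intro d _
    simp
  smul_mem' := by
    intro a x hx d hd
    simp only [Pi.smul_apply, smul_eq_mul, mul_assoc, ← Finset.mul_sum, hx d hd, mul_zero]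

/-- A linear code is LCD (linear complementary dual) if it meets its Euclidean dual trivially. -/
def IsLCD {A ι : Type*} [CommRing A] [Fintype ι] (D : Submodule A (ι → A)) : Prop :=
  D ⊓ euclideanDual D = ⊥

/-- Closure under the cyclic shift `(c_0, …, c_{ℓ-1}) ↦ (c_{ℓ-1}, c_0, …, c_{ℓ-2})`. -/
def IsCyclicCode {A : Type*} [CommRing A] {ℓ : ℕ} (D : Submodule A (Fin ℓ → A)) : Prop :=
  ∀ c ∈ D, (fun b => c ((finRotate ℓ).symm b)) ∈ D

/-- `(c_0, …, c_{ℓ-1}) ∈ D` implies `(c_{ℓ-1}, …, c_0) ∈ D`. -/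
def IsReversible {E : Type*} [Field E] {ℓ : ℕ} (D : Submodule E (Fin ℓ → E)) : Prop :=
  ∀ c ∈ D, (fun b => c (Fin.rev b)) ∈ D

/-- Conjugation on an extension `E` of degree `r` of the finite field `F` with `q` elements.
For even `r` it is the map `y ↦ y ^ √Q`, where `Q = q ^ r` is the cardinality of `E`, as
`√Q = q ^ (r / 2)`. For `r = 1` it is the identity (`r / 2 = 0` in `ℕ`). -/
def conjugation (F : Type*) {E : Type*} [Field F] [Field E] [Algebra F E] (y : E) : E :=
  y ^ (Nat.card F ^ (Module.finrank F E / 2))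

/-- `(c_0, …, c_{ℓ-1}) ∈ D` implies that the conjugate of `(c_{ℓ-1}, …, c_0)` is in `D`. -/
def IsConjugateReversible (F : Type*) {E : Type*} [Field F] [Field E] [Algebra F E] {ℓ : ℕ}
    (D : Submodule E (Fin ℓ → E)) : Prop :=
  ∀ c ∈ D, (fun b => conjugation F (c (Fin.rev b))) ∈ D

/-- The ring `R = F[x] / ⟨x ^ m - 1⟩`. -/
abbrev CyclicRing (F : Type*) [Field F] (m : ℕ) : Type _ :=
  AdjoinRoot (X ^ m - 1 : F[X])

/-- The identification of `F ^ (m ℓ)` with `R ^ ℓ`: the array `(a_{k,b})` corresponds to the vector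
whose `b`-th coordinate is the class of `∑ k, a_{k,b} x ^ k`. -/
def arrayToVec (F : Type*) [Field F] (m ℓ : ℕ) :
    (Fin m × Fin ℓ → F) →ₗ[F] (Fin ℓ → CyclicRing F m) where
  toFun a := fun b => ∑ k : Fin m, a (k, b) • (AdjoinRoot.root (X ^ m - 1 : F[X])) ^ (k : ℕ)
  map_add' := by
    intro a a'
    funext b
    simp only [Pi.add_apply, add_smul, Finset.sum_add_distrib]
  map_smul' := by
    intro r a
    funext b
    simp only [Pi.smul_apply, smul_eq_mul, mul_smul, Finset.smul_sum, RingHom.id_apply]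

/-- An `R`-submodule of `R ^ ℓ`, viewed as an `F`-linear code of length `m ℓ`. -/
def arrayCode {F : Type*} [Field F] {m ℓ : ℕ}
    (C : Submodule (CyclicRing F m) (Fin ℓ → CyclicRing F m)) :
    Submodule F (Fin m × Fin ℓ → F) :=
  (C.restrictScalars F).comap (arrayToVec F m ℓ)

/-- The constituent of `C ⊆ R ^ ℓ` over the extension `E` of `F` at the `m`-th root of unity
`β : E`: the `E`-span of the vectors `(c_1(β), …, c_ℓ(β))` for `(c_1(x), …, c_ℓ(x)) ∈ C`.
Elements of `R` are given by arbitrary polynomial representatives, whose values at `β` do not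
depend on the choice as `β ^ m = 1`. -/
def constituent {F E : Type*} [Field F] [Field E] [Algebra F E] {m ℓ : ℕ}
    (C : Submodule (CyclicRing F m) (Fin ℓ → CyclicRing F m)) (β : E) :
    Submodule E (Fin ℓ → E) :=
  Submodule.span E {w | ∃ p : Fin ℓ → F[X],
    (fun b => AdjoinRoot.mk (X ^ m - 1 : F[X]) (p b)) ∈ C ∧ w = fun b => aeval β (p b)}

/-- The monic reciprocal `f_0⁻¹ x ^ (deg f) f(x⁻¹)` of a polynomial with constant coefficient
`f_0 ≠ 0`. -/
def monicReciprocal {F : Type*} [Field F] (f : F[X]) : F[X] :=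
  Polynomial.C (f.coeff 0)⁻¹ * f.reverse

end

/-! Let `a` lie in the code and in its dual, and let `a(γ)` be the vector of values at `γ` of its
column polynomials. These have degree below `m`, so it suffices that `a(γ) = 0` for every `m`-th
root of unity `γ`; by irreducibility one root of each factor is enough. Since the code is stable
under multiplication by `x`, orthogonality to all shifts makes `a(β⁻¹)` orthogonal to the
constituent at `β` (`sum_columnValues_inv_mul_eq_zero`). At a root of `g_i`, conjugation `τ` inverts
`β` (`conjugation_gen_eq_inv`), so `a(β⁻¹) = τ(a(β))`; for a pair `h_j`, `h_j^*` the equality of the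
two constituents plays this role, with `τ = id`. So `w = a(β)` lies in a cyclic code stable under
`τ` with reversal, and `τ(w)` is orthogonal to it. Testing against reversed shifts of `w` gives
`w(y)² = 0` modulo `y^ℓ - 1`, which is squarefree as `ℓ` is prime to `q`; hence `w = 0`. -/

/-- A polynomial with `n` coefficients vanishing at all `n`-th roots of unity is zero. -/
theorem eq_zero_of_forall_sum_mul_pow_eq_zero {K : Type*} [Field K] {n : ℕ} {ξ : K}
    (hξ : IsPrimitiveRoot ξ n) (c : Fin n → K)
    (hc : ∀ γ : K, γ ^ n = 1 → ∑ i, c i * γ ^ (i : ℕ) = 0) : c = 0 := by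
  refine Matrix.eq_zero_of_forall_index_sum_mul_pow_eq_zero (f := fun j : Fin n => ξ ^ (j : ℕ))
    (fun i j hij => Fin.ext (hξ.pow_inj i.2 j.2 hij)) fun j => hc _ ?_
  rw [← pow_mul, mul_comm, pow_mul, hξ.pow_eq_one, one_pow]

theorem pow_val_add_of_pow_eq_one {M : Type*} [Monoid M] {n : ℕ} {γ : M} (hγ : γ ^ n = 1)
    (i j : Fin n) : γ ^ ((i + j : Fin n) : ℕ) = γ ^ (i : ℕ) * γ ^ (j : ℕ) := by
  rw [Fin.val_add, ← pow_add]
  exact (pow_eq_pow_mod _ hγ).symm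

theorem IsCyclicCode.comp_sub_mem {A : Type*} [CommRing A] {ℓ : ℕ} [NeZero ℓ]
    {D : Submodule A (Fin ℓ → A)} (hD : IsCyclicCode D) {c : Fin ℓ → A} (hc : c ∈ D)
    (j : Fin ℓ) : (fun b => c (b - j)) ∈ D := by
  have key : ∀ n : ℕ, (fun b => c (b - Fin.ofNat ℓ n)) ∈ D := by
    intro n
    induction n with
    | zero => simpa using! hc
    | succ n ih =>
      convert hD _ ih using 2 with b
      have h1 : (finRotate ℓ).symm b = b - 1 := by
        rw [Equiv.symm_apply_eq, finRotate_apply, sub_add_cancel]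
      have h2 : Fin.ofNat ℓ (n + 1) = Fin.ofNat ℓ n + 1 := by
        apply Fin.ext
        simp [Fin.val_add]
      rw [h1, h2, sub_sub, add_comm]
  simpa using! key j

/-- A vector of length prime to the characteristic whose cyclic convolution square vanishes
is zero. -/
theorem eq_zero_of_cyclic_convolution_self_eq_zero {E : Type*} [Field E] {ℓ : ℕ} [NeZero ℓ]
    (hℓ : (ℓ : E) ≠ 0) (w : Fin ℓ → E) (hw : ∀ k, ∑ b, w b * w (k - b) = 0) : w = 0 := by
  have : NeZero (ℓ : AlgebraicClosure E) :=
    ⟨by rwa [← map_natCast (algebraMap E (AlgebraicClosure E)), ne_eq,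
      FaithfulSMul.algebraMap_eq_zero_iff]⟩
  obtain ⟨η, hη⟩ := HasEnoughRootsOfUnity.exists_primitiveRoot (AlgebraicClosure E) ℓ
  have h0 := eq_zero_of_forall_sum_mul_pow_eq_zero hη (fun i => algebraMap E _ (w i)) ?_
  · funext i
    simpa using congrFun h0 i
  · intro γ hγ
    -- The square of the value at `γ` is the value at `γ` of the cyclic convolution of `w` with
    -- itself.
    rw [← mul_self_eq_zero, Finset.sum_mul_sum]
    calc _ = ∑ b, ∑ k, algebraMap E (AlgebraicClosure E) (w b * w (k - b)) * γ ^ (k : ℕ) := by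
          refine Finset.sum_congr rfl fun b _ => ?_
          refine Eq.trans ?_ (Equiv.sum_comp (Equiv.addRight b) _)
          refine Finset.sum_congr rfl fun k _ => ?_
          simp only [Equiv.coe_addRight, add_sub_cancel_right, map_mul,
            pow_val_add_of_pow_eq_one hγ]
          ring
      _ = 0 := by
          rw [Finset.sum_comm]
          refine Finset.sum_eq_zero fun k _ => ?_
          rw [← Finset.sum_mul, ← map_sum, hw, map_zero, zero_mul]

/-- A cyclic code of length prime to the characteristic that is stable under reversal composed
with a field endomorphism `τ` meets its `τ`-twisted dual trivially. -/
theorem IsCyclicCode.eq_zero_of_twisted_orthogonal {E : Type*} [Field E] {ℓ : ℕ}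
    (hℓ : (ℓ : E) ≠ 0) (τ : E →+* E) {D : Submodule E (Fin ℓ → E)} (hD : IsCyclicCode D)
    (hrev : ∀ c ∈ D, (fun b => τ (c (Fin.rev b))) ∈ D) {w : Fin ℓ → E} (hw : w ∈ D)
    (horth : ∀ d ∈ D, ∑ b, τ (w b) * d b = 0) : w = 0 := by
  obtain _ | ℓ := ℓ
  · simp at hℓ
  refine eq_zero_of_cyclic_convolution_self_eq_zero hℓ w fun k => ?_
  -- Reversal is `b ↦ last - b`, so this shift turns the index into `k - b`; injectivity of `τ` then
  -- removes it from the sum.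
  have h := horth _ (hrev _ (hD.comp_sub_mem hw (Fin.last ℓ - k)))
  simp only [← map_mul, ← map_sum, map_eq_zero] at h
  rw [← h]
  refine Finset.sum_congr rfl fun b _ => ?_
  rw [← Fin.last_sub]
  congr 2
  abel

/-! ### Evaluation of arrays at roots of unity -/

section Constituent

variable {F E : Type*} [Field F] [Field E] [Algebra F E] {m ℓ : ℕ}
  {C : Submodule (CyclicRing F m) (Fin ℓ → CyclicRing F m)}

theorem IsCyclicCode.constituent (hC : IsCyclicCode C) (β : E) :
    IsCyclicCode (constituent C β) := by
  intro c hc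
  unfold _root_.constituent at hc ⊢
  induction hc using Submodule.span_induction with
  | mem w hw =>
    obtain ⟨p, hp, rfl⟩ := hw
    exact Submodule.subset_span ⟨fun b => p ((finRotate ℓ).symm b), hC _ hp, rfl⟩
  | zero => exact Submodule.zero_mem _
  | add x y _ _ hx hy => exact Submodule.add_mem _ hx hy
  | smul r x _ hx => exact Submodule.smul_mem _ r hx

theorem arrayToVec_apply_eq_mk (a : Fin m × Fin ℓ → F) (b : Fin ℓ) :
    arrayToVec F m ℓ a b =
      AdjoinRoot.mk (X ^ m - 1 : F[X]) (∑ k : Fin m, a (k, b) • X ^ (k : ℕ)) := by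
  simp only [arrayToVec, LinearMap.coe_mk, AddHom.coe_mk, map_sum]
  refine Finset.sum_congr rfl fun k _ => ?_
  rw [← AdjoinRoot.smul_mk, map_pow, AdjoinRoot.mk_X]

/-- The values at `β` of the polynomials given by the columns of an array. -/
noncomputable def columnValues (β : E) (a : Fin m × Fin ℓ → F) (b : Fin ℓ) : E :=
  ∑ k : Fin m, algebraMap F E (a (k, b)) * β ^ (k : ℕ)

theorem columnValues_eq_aeval (β : E) (a : Fin m × Fin ℓ → F) (b : Fin ℓ) :
    columnValues β a b = aeval β (∑ k : Fin m, a (k, b) • X ^ (k : ℕ) : F[X]) := by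
  simp [columnValues, Algebra.smul_def]

theorem columnValues_mem_constituent (β : E) {a : Fin m × Fin ℓ → F} (ha : a ∈ arrayCode C) :
    columnValues β a ∈ constituent C β := by
  refine Submodule.subset_span ⟨fun b => ∑ k : Fin m, a (k, b) • X ^ (k : ℕ), ?_, ?_⟩
  · convert (show arrayToVec F m ℓ a ∈ C from ha) using 2 with b
    exact (arrayToVec_apply_eq_mk a b).symm
  · funext b
    exact columnValues_eq_aeval β a b

/-- Multiplication by `x ^ j` rotates the rows, because `x ^ m = 1` in `R`. -/
theorem arrayCode_comp_sub_mem {d : Fin m × Fin ℓ → F} (hd : d ∈ arrayCode C) (j : Fin m) :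
    (fun i : Fin m × Fin ℓ => d (i.1 - j, i.2)) ∈ arrayCode C := by
  have : NeZero m := j.neZero
  have hr : AdjoinRoot.root (X ^ m - 1 : F[X]) ^ m = 1 := by
    have := AdjoinRoot.eval₂_root (X ^ m - 1 : F[X])
    simpa [sub_eq_zero] using this
  change arrayToVec F m ℓ _ ∈ C
  have h : arrayToVec F m ℓ (fun i : Fin m × Fin ℓ => d (i.1 - j, i.2)) =
      AdjoinRoot.root (X ^ m - 1 : F[X]) ^ (j : ℕ) • arrayToVec F m ℓ d := by
    funext b
    simp only [arrayToVec, LinearMap.coe_mk, AddHom.coe_mk, Pi.smul_apply, smul_eq_mul]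
    rw [← Equiv.sum_comp (Equiv.addRight j), Finset.mul_sum]
    refine Finset.sum_congr rfl fun k _ => ?_
    simp only [Equiv.coe_addRight, add_sub_cancel_right, pow_val_add_of_pow_eq_one hr]
    rw [mul_smul_comm, mul_comm]
  rw [h]
  exact Submodule.smul_mem _ _ hd

theorem exists_columnValues_eq (hm : m ≠ 0) {β : E} (hβ : β ^ m = 1) (p : Fin ℓ → F[X])
    (hp : (fun b => AdjoinRoot.mk (X ^ m - 1 : F[X]) (p b)) ∈ C) :
    ∃ d ∈ arrayCode C, columnValues β d = fun b => aeval β (p b) := by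
  have hmonic : (X ^ m - 1 : F[X]).Monic := monic_X_pow_sub_C 1 hm
  have hsum : ∀ b, ∑ k : Fin m, (p b %ₘ (X ^ m - 1)).coeff k • (X : F[X]) ^ (k : ℕ) =
      p b %ₘ (X ^ m - 1) := by
    intro b
    have hdeg : (p b %ₘ (X ^ m - 1)).natDegree < m := by
      have := natDegree_modByMonic_lt (p b) hmonic (by
        intro h
        have := congrArg natDegree h
        rw [← C_1, natDegree_X_pow_sub_C, C_1, natDegree_one] at this
        exact hm this)
      rwa [← C_1, natDegree_X_pow_sub_C] at this
    conv_rhs => rw [as_sum_range' _ m hdeg]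
    rw [← Fin.sum_univ_eq_sum_range
      (fun k => monomial k ((p b %ₘ (X ^ m - 1)).coeff k))]
    simp [← C_mul_X_pow_eq_monomial, smul_eq_C_mul]
  refine ⟨fun i => (p i.2 %ₘ (X ^ m - 1)).coeff i.1, ?_, ?_⟩
  · change arrayToVec F m ℓ _ ∈ C
    convert hp using 2 with b
    rw [arrayToVec_apply_eq_mk, hsum, AdjoinRoot.mk_eq_mk, modByMonic_eq_sub_mul_div]
    exact ⟨-(p b /ₘ (X ^ m - 1)), by ring⟩
  · funext b
    rw [columnValues_eq_aeval, hsum, modByMonic_eq_sub_mul_div]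
    simp [hβ]

/-- Orthogonality of arrays passes to the values of the columns at mutually inverse roots of
unity. -/
theorem sum_columnValues_inv_mul_eq_zero (hm : m ≠ 0) {β : E} (hβ : β ^ m = 1)
    {a : Fin m × Fin ℓ → F} (ha : a ∈ euclideanDual (arrayCode C)) {d : Fin ℓ → E}
    (hd : d ∈ constituent C β) : ∑ b, columnValues β⁻¹ a b * d b = 0 := by
  have : NeZero m := ⟨hm⟩
  have hβ0 : β ≠ 0 := by
    rintro rfl
    simp [hm] at hβ
  unfold constituent at hd
  induction hd using Submodule.span_induction with
  | mem w hw =>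
    obtain ⟨p, hp, rfl⟩ := hw
    obtain ⟨d, hd, hdp⟩ := exists_columnValues_eq hm hβ p hp
    rw [← hdp]
    have hβ' : β⁻¹ ^ m = 1 := by rw [inv_pow, hβ, inv_one]
    -- With row indices `k + j` in `a` and `k` in `d`, the powers of `β` combine to `β⁻¹ ^ j`, whose
    -- coefficient is the inner product of `a` with the `j`-th row shift of `d`.
    calc ∑ b, columnValues β⁻¹ a b * columnValues β d b
        = ∑ b, ∑ k : Fin m, ∑ j : Fin m,
            algebraMap F E (a (k + j, b) * d (k, b)) * β⁻¹ ^ (j : ℕ) := by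
          refine Finset.sum_congr rfl fun b _ => ?_
          rw [columnValues, columnValues, Finset.sum_mul_sum, Finset.sum_comm]
          refine Finset.sum_congr rfl fun k _ => ?_
          rw [← Equiv.sum_comp (Equiv.addLeft k)]
          refine Finset.sum_congr rfl fun j _ => ?_
          simp only [Equiv.coe_addLeft, pow_val_add_of_pow_eq_one hβ', map_mul, inv_pow]
          field_simp
      _ = ∑ j : Fin m, algebraMap F E (∑ i : Fin m × Fin ℓ, a i * d (i.1 - j, i.2)) *
            β⁻¹ ^ (j : ℕ) := by
          rw [Finset.sum_congr rfl fun b _ => Finset.sum_comm, Finset.sum_comm]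
          refine Finset.sum_congr rfl fun j _ => ?_
          rw [Fintype.sum_prod_type_right, map_sum, Finset.sum_mul]
          refine Finset.sum_congr rfl fun b _ => ?_
          rw [← Finset.sum_mul, ← map_sum,
            ← Equiv.sum_comp (Equiv.addRight j) fun k : Fin m => a (k, b) * d (k - j, b)]
          simp only [Equiv.coe_addRight, add_sub_cancel_right]
      _ = 0 := by
          refine Finset.sum_eq_zero fun j _ => ?_
          rw [ha _ (arrayCode_comp_sub_mem hd j), map_zero, zero_mul]
  | zero => simp
  | add x y _ _ hx hy => simp [mul_add, Finset.sum_add_distrib, hx, hy]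
  | smul r x _ hx =>
    simp only [Pi.smul_apply, smul_eq_mul, mul_left_comm _ r]
    rw [← Finset.mul_sum, hx, mul_zero]

end Constituent

/-! ### Reciprocal polynomials and conjugation -/

theorem aeval_inv_reverse_eq_zero_iff {F K : Type*} [Field F] [Field K] [Algebra F K] {γ : K}
    (hγ : γ ≠ 0) (f : F[X]) : aeval γ⁻¹ f.reverse = 0 ↔ aeval γ f = 0 := by
  have := invertibleOfNonzero hγ
  have h := eval₂_reverse_eq_zero_iff (algebraMap F K) γ f
  rwa [invOf_eq_inv] at h

theorem aeval_monicReciprocal_eq_zero_iff {F K : Type*} [Field F] [Field K] [Algebra F K]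
    {f : F[X]} (hf : f.coeff 0 ≠ 0) (γ : K) :
    aeval γ (monicReciprocal f) = 0 ↔ aeval γ f.reverse = 0 := by
  simp [monicReciprocal, hf]

/-- An element of a finite extension of a finite field that generates it and is conjugate to its
inverse is inverted by `conjugation`. -/
theorem conjugation_gen_eq_inv {F K : Type*} [Field F] [Finite F] [Field K] [Algebra F K]
    {β : K} {g : F[X]} (hg : Irreducible g) (hβ : aeval β g = 0) (hβ' : aeval β⁻¹ g = 0) :
    conjugation F (IntermediateField.AdjoinSimple.gen F β) =
      (IntermediateField.AdjoinSimple.gen F β)⁻¹ := by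
  have := Fintype.ofFinite F
  have hint : IsIntegral F β := IsAlgebraic.isIntegral ⟨g, hg.ne_zero, hβ⟩
  set E := IntermediateField.adjoin F {β}
  set x : E := IntermediateField.AdjoinSimple.gen F β
  have hxβ : algebraMap E K x = β := IntermediateField.AdjoinSimple.algebraMap_gen F β
  have : FiniteDimensional F E := IntermediateField.adjoin.finiteDimensional hint
  obtain ⟨σ, hσ⟩ : ∃ σ : E →ₐ[F] E, σ x = x⁻¹ := by
    have hmin : aeval x⁻¹ (minpoly F β) = 0 := by
      rw [← minpoly.eq_of_irreducible hg hβ]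
      simp only [map_mul, mul_eq_zero]
      left
      apply (algebraMap E K).injective
      rw [map_zero, ← aeval_algebraMap_apply, map_inv₀, hxβ, hβ']
    exact ⟨(IntermediateField.algHomAdjoinIntegralEquiv F hint).symm
      ⟨x⁻¹, (mem_aroots.mpr ⟨minpoly.ne_zero hint, hmin⟩)⟩,
      IntermediateField.algHomAdjoinIntegralEquiv_symm_apply_gen F hint _⟩
  have : Finite E := Module.finite_of_finite F
  have hext : ∀ φ ψ : E →ₐ[F] E, φ x = ψ x → φ = ψ := by
    refine fun φ ψ h => IntermediateField.adjoin_algHom_ext F ?_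
    rintro y rfl
    exact h
  obtain ⟨⟨n, hlt⟩, hn⟩ := (FiniteField.bijective_frobeniusAlgHom_pow F E).2 σ
  have hord := FiniteField.orderOf_frobeniusAlgHom F E
  have hsq : σ ^ 2 = 1 := hext _ _ (by simp [pow_two, hσ])
  -- Frobenius has order `r = [E : F]`, and `σ` is its `n`-th power with `n < r`. As `σ ^ 2 = 1`,
  -- either `n = 0` or `2n = r`; in the first case `x = x⁻¹` lies in `F`, so `r = 1` and `r / 2 =
  -- 0`.
  have hdvd : Module.finrank F E ∣ n * 2 := by
    rw [← hord, orderOf_dvd_iff_pow_eq_one, pow_mul]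
    rw [← hn] at hsq
    exact hsq
  have hhalf : n = Module.finrank F E / 2 := by
    obtain hn0 | hn0 := Nat.eq_zero_or_pos n
    · have hσ1 : σ = 1 := by rw [← hn]; simp [hn0]
      have hxx : x = x⁻¹ := by rw [← hσ, hσ1]; rfl
      have hmem : x ∈ (⊥ : Subalgebra F E) := by
        -- Since `0⁻¹ = 0`, the equation `x = x⁻¹` does not rule out zero.
        by_cases hx0 : x = 0
        · rw [hx0]; exact zero_mem _
        have : x * x = 1 := by nth_rw 2 [hxx]; exact mul_inv_cancel₀ hx0
        rcases mul_self_eq_one_iff.mp this with h | h <;> rw [h]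
        · exact one_mem _
        · exact neg_mem (one_mem _)
      obtain ⟨y, hy⟩ := Algebra.mem_bot.mp hmem
      have hβmem : β ∈ (⊥ : IntermediateField F K) := by
        refine IntermediateField.mem_bot.mpr ⟨y, ?_⟩
        rw [← hxβ, ← hy, ← IsScalarTower.algebraMap_apply]
      have : Module.finrank F E = 1 := IntermediateField.finrank_adjoin_simple_eq_one_iff.mpr hβmem
      omega
    · obtain ⟨k, hk⟩ := hdvd
      have : k = 1 := by
        have h1 : k < 2 := by
          by_contra! h
          have := Nat.mul_le_mul_left (Module.finrank F E) h
          omega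
        have h2 : k ≠ 0 := by
          rintro rfl
          omega
        omega
      subst this
      omega
  have hpow : (FiniteField.frobeniusAlgHom F E ^ n) x = x ^ (Fintype.card F ^ n) := by
    rw [AlgHom.coe_pow, FiniteField.coe_frobeniusAlgHom, pow_iterate]
  rw [conjugation, Nat.card_eq_fintype_card, ← hhalf, ← hpow, ← hσ, ← hn]

/-- `conjugation` as an algebra endomorphism. -/
theorem exists_algHom_eq_conjugation (F E : Type*) [Field F] [Finite F] [Field E] [Algebra F E] :
    ∃ τ : E →ₐ[F] E, ∀ y, τ y = conjugation F y := by
  have := Fintype.ofFinite F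
  refine ⟨FiniteField.frobeniusAlgHom F E ^ (Module.finrank F E / 2), fun y => ?_⟩
  rw [AlgHom.coe_pow, FiniteField.coe_frobeniusAlgHom, pow_iterate, conjugation,
    Nat.card_eq_fintype_card]

theorem map_columnValues {F E : Type*} [Field F] [Field E] [Algebra F E] {m ℓ : ℕ}
    (τ : E →ₐ[F] E) (β : E) (a : Fin m × Fin ℓ → F) (b : Fin ℓ) :
    τ (columnValues β a b) = columnValues (τ β) a b := by
  simp [columnValues]

theorem natCast_ne_zero_of_coprime_card {F : Type*} [Field F] [Finite F] {n : ℕ}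
    (hn : Nat.Coprime n (Nat.card F)) : (n : F) ≠ 0 := by
  have := Fintype.ofFinite F
  intro h0
  have h := Nat.Coprime.cast (R := F) hn
  rw [Nat.card_eq_fintype_card, FiniteField.cast_card_eq_zero, h0] at h
  simp at h

/-- Due to the convention `0⁻¹ = 0`. It lets nonzero constant coefficients be deduced from the
factorization data. -/
theorem monicReciprocal_eq_zero {F : Type*} [Field F] {f : F[X]} (hf : f.coeff 0 = 0) :
    monicReciprocal f = 0 := by
  simp [monicReciprocal, hf]

theorem aeval_monicReciprocal_inv_eq_zero_iff {F K : Type*} [Field F] [Field K] [Algebra F K]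
    {f : F[X]} (hf : f.coeff 0 ≠ 0) {γ : K} (hγ : γ ≠ 0) :
    aeval γ⁻¹ (monicReciprocal f) = 0 ↔ aeval γ f = 0 := by
  rw [aeval_monicReciprocal_eq_zero_iff hf, aeval_inv_reverse_eq_zero_iff hγ]

/-- A polynomial vanishing at one root of an irreducible polynomial vanishes at all its roots. -/
theorem Irreducible.aeval_eq_zero_of_common_root {F K L : Type*} [Field F] [Field K] [Algebra F K]
    [Field L] [Algebra F L] {g p : F[X]} (hg : Irreducible g) {β : K} (hgβ : aeval β g = 0)
    (hpβ : aeval β p = 0) {γ : L} (hgγ : aeval γ g = 0) : aeval γ p = 0 := by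
  have hdvd : g ∣ p := by
    refine dvd_trans ?_ (minpoly.dvd F β hpβ)
    rw [← minpoly.eq_of_irreducible hg hgβ]
    exact dvd_mul_right _ _
  obtain ⟨r, rfl⟩ := hdvd
  rw [map_mul, hgγ, zero_mul]

/-! ### Vanishing at the roots of each factor, and conclusion -/

section Constituent

variable {F E : Type*} [Field F] [Finite F] [Field E] [Algebra F E] {m ℓ : ℕ}
  {C : Submodule (CyclicRing F m) (Fin ℓ → CyclicRing F m)}

theorem columnValues_eq_zero_of_isConjugateReversible (hm : m ≠ 0)
    (hℓ : Nat.Coprime ℓ (Nat.card F)) {β : E} (hβ : β ^ m = 1)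
    (hconj : conjugation F β = β⁻¹) (hC : IsCyclicCode C)
    (hrev : IsConjugateReversible F (constituent C β)) {a : Fin m × Fin ℓ → F}
    (ha : a ∈ arrayCode C) (ha' : a ∈ euclideanDual (arrayCode C)) : columnValues β a = 0 := by
  obtain ⟨τ, hτ⟩ := exists_algHom_eq_conjugation F E
  have hℓE : (ℓ : E) ≠ 0 := by
    rw [← map_natCast (algebraMap F E), ne_eq, FaithfulSMul.algebraMap_eq_zero_iff]
    exact natCast_ne_zero_of_coprime_card hℓ
  refine (hC.constituent β).eq_zero_of_twisted_orthogonal hℓE τ.toRingHom ?_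
    (columnValues_mem_constituent β ha) fun d hd => ?_
  · intro c hc
    simpa [hτ] using! hrev c hc
  · rw [← sum_columnValues_inv_mul_eq_zero hm hβ ha' hd]
    refine Finset.sum_congr rfl fun b _ => ?_
    rw [← hconj, ← hτ, ← map_columnValues]
    rfl

theorem columnValues_eq_zero_of_isReversible (hm : m ≠ 0)
    (hℓ : Nat.Coprime ℓ (Nat.card F)) {β : E} (hβ : β ^ m = 1) (hC : IsCyclicCode C)
    (heq : constituent C β = constituent C β⁻¹) (hrev : IsReversible (constituent C β))
    {a : Fin m × Fin ℓ → F} (ha : a ∈ arrayCode C) (ha' : a ∈ euclideanDual (arrayCode C)) :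
    columnValues β a = 0 := by
  have hℓE : (ℓ : E) ≠ 0 := by
    rw [← map_natCast (algebraMap F E), ne_eq, FaithfulSMul.algebraMap_eq_zero_iff]
    exact natCast_ne_zero_of_coprime_card hℓ
  refine (hC.constituent β).eq_zero_of_twisted_orthogonal hℓE (RingHom.id E) hrev
    (columnValues_mem_constituent β ha) fun d hd => ?_
  -- Viewed in the constituent at `β⁻¹`, `d` is orthogonal to the values of `a` at `(β⁻¹)⁻¹ = β`.
  rw [heq] at hd
  have := sum_columnValues_inv_mul_eq_zero hm (by rw [inv_pow, hβ, inv_one]) ha' hd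
  simpa using this

theorem columnValues_eq_zero_of_isReversible_inv (hm : m ≠ 0)
    (hℓ : Nat.Coprime ℓ (Nat.card F)) {β : E} (hβ : β ^ m = 1) (hC : IsCyclicCode C)
    (heq : constituent C β = constituent C β⁻¹) (hrev : IsReversible (constituent C β))
    {a : Fin m × Fin ℓ → F} (ha : a ∈ arrayCode C) (ha' : a ∈ euclideanDual (arrayCode C)) :
    columnValues β⁻¹ a = 0 :=
  columnValues_eq_zero_of_isReversible hm hℓ (by rw [inv_pow, hβ, inv_one]) hC
    (by rw [inv_inv, heq]) (heq ▸ hrev) ha ha'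

end Constituent

theorem theorem4p4 {F : Type*} [Field F] [Finite F] (m ℓ : ℕ)
    (hm : Nat.Coprime m (Nat.card F)) (hℓ : Nat.Coprime ℓ (Nat.card F))
    -- the factorization of `x ^ m - 1` into irreducible polynomials
    (s t : ℕ) (g : Fin s → F[X]) (h : Fin t → F[X])
    (hg_irr : ∀ i, Irreducible (g i)) (hg_self : ∀ i, monicReciprocal (g i) = g i)
    (hh_irr : ∀ j, Irreducible (h j))
    (hfac : (X ^ m - 1 : F[X]) = (∏ i, g i) * ∏ j, (h j * monicReciprocal (h j)))
    -- a primitive `m`-th root of unity, and its powers that are roots of the factors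
    {K : Type*} [Field K] [Algebra F K] (ξ : K) (hξ : IsPrimitiveRoot ξ m)
    (u : Fin s → ℕ) (hu : ∀ i, aeval (ξ ^ u i) (g i) = 0)
    (v : Fin t → ℕ) (hv : ∀ j, aeval (ξ ^ v j) (h j) = 0)
    -- a 2D cyclic code
    (C : Submodule (CyclicRing F m) (Fin ℓ → CyclicRing F m)) (hC : IsCyclicCode C)
    -- the constituents `C_i` over `G_i = F(ξ ^ u_i)`
    (hCi : ∀ i, IsConjugateReversible F
      (constituent C (IntermediateField.AdjoinSimple.gen F (ξ ^ u i))))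
    -- the constituents `C_j'`, `C_j''` over `F(ξ ^ v_j) = F(ξ ^ (-v_j))`
    (hCj_eq : ∀ j, constituent C (IntermediateField.AdjoinSimple.gen F (ξ ^ v j)) =
      constituent C (IntermediateField.AdjoinSimple.gen F (ξ ^ v j))⁻¹)
    (hCj_rev : ∀ j, IsReversible
      (constituent C (IntermediateField.AdjoinSimple.gen F (ξ ^ v j)))) :
    IsLCD (arrayCode C) := by
  have hm0 : m ≠ 0 := by
    rintro rfl
    simpa using natCast_ne_zero_of_coprime_card hm
  have hξ0 : ξ ≠ 0 := hξ.ne_zero hm0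
  have hroot : ∀ n : ℕ, (IntermediateField.AdjoinSimple.gen F (ξ ^ n)) ^ m = 1 := by
    intro n
    apply Subtype.ext
    change (ξ ^ n) ^ m = 1
    rw [← pow_mul, mul_comm, pow_mul, hξ.pow_eq_one, one_pow]
  have hmap : ∀ (n : ℕ) (a : Fin m × Fin ℓ → F) (b : Fin ℓ),
      columnValues (IntermediateField.AdjoinSimple.gen F (ξ ^ n)) a = 0 →
        columnValues (ξ ^ n) a b = 0 := by
    intro n a b h0
    have := congrArg (algebraMap _ K) (congrFun h0 b)
    rw [columnValues_eq_aeval, ← aeval_algebraMap_apply, Pi.zero_apply, map_zero] at this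
    rwa [columnValues_eq_aeval]
  have hmap_inv : ∀ (n : ℕ) (a : Fin m × Fin ℓ → F) (b : Fin ℓ),
      columnValues (IntermediateField.AdjoinSimple.gen F (ξ ^ n))⁻¹ a = 0 →
        columnValues (ξ ^ n)⁻¹ a b = 0 := by
    intro n a b h0
    have := congrArg (algebraMap _ K) (congrFun h0 b)
    rw [columnValues_eq_aeval, ← aeval_algebraMap_apply, Pi.zero_apply, map_zero] at this
    rwa [columnValues_eq_aeval]
  have hne : (X ^ m - 1 : F[X]) ≠ 0 := X_pow_sub_C_ne_zero (Nat.pos_of_ne_zero hm0) 1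
  have hg0 : ∀ i, (g i).coeff 0 ≠ 0 := fun i h0 =>
    (hg_irr i).ne_zero (by rw [← hg_self i, monicReciprocal_eq_zero h0])
  have hh0 : ∀ j, (h j).coeff 0 ≠ 0 := fun j h0 => by
    refine hne ?_
    rw [hfac, Finset.prod_eq_zero (Finset.mem_univ j), mul_zero]
    rw [monicReciprocal_eq_zero h0, mul_zero]
  have hinv : ∀ i, aeval (ξ ^ u i)⁻¹ (g i) = 0 := fun i => by
    rw [← hg_self i, aeval_monicReciprocal_inv_eq_zero_iff (hg0 i) (pow_ne_zero _ hξ0), hu]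
  rw [IsLCD, eq_bot_iff]
  rintro a ⟨ha, ha'⟩
  have hvanish : ∀ (b : Fin ℓ) (γ : K), γ ^ m = 1 → columnValues γ a b = 0 := by
    intro b γ hγ
    have hγ0 : γ ≠ 0 := by
      rintro rfl
      simp [hm0] at hγ
    have hprod := congrArg (aeval γ) hfac
    simp only [map_sub, map_pow, aeval_X, map_one, hγ, sub_self, map_mul, map_prod] at hprod
    rcases mul_eq_zero.mp hprod.symm with hp | hp
    · obtain ⟨i, -, hi⟩ := Finset.prod_eq_zero_iff.mp hp
      have h0 := hmap (u i) a b <| columnValues_eq_zero_of_isConjugateReversible hm0 hℓ (hroot _)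
        (conjugation_gen_eq_inv (hg_irr i) (hu i) (hinv i)) hC (hCi i) ha ha'
      rw [columnValues_eq_aeval] at h0 ⊢
      exact (hg_irr i).aeval_eq_zero_of_common_root (hu i) h0 hi
    · obtain ⟨j, -, hj⟩ := Finset.prod_eq_zero_iff.mp hp
      rcases mul_eq_zero.mp hj with hj | hj
      · have h0 := hmap (v j) a b <| columnValues_eq_zero_of_isReversible hm0 hℓ (hroot _) hC
          (hCj_eq j) (hCj_rev j) ha ha'
        rw [columnValues_eq_aeval] at h0 ⊢
        exact (hh_irr j).aeval_eq_zero_of_common_root (hv j) h0 hj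
      · have h0 := hmap_inv (v j) a b <| columnValues_eq_zero_of_isReversible_inv hm0 hℓ
          (hroot _) hC (hCj_eq j) (hCj_rev j) ha ha'
        rw [columnValues_eq_aeval] at h0 ⊢
        -- Passing to the reversed column polynomial moves the question to the roots `ξ ^ v j` and
        -- `γ⁻¹` of `h j`, so only irreducibility of `h j` is needed, not that of its reciprocal.
        rw [← inv_inv γ, aeval_monicReciprocal_inv_eq_zero_iff (hh0 j) (inv_ne_zero hγ0)] at hj
        rw [← aeval_inv_reverse_eq_zero_iff hγ0]
        refine (hh_irr j).aeval_eq_zero_of_common_root (hv j) ?_ hj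
        rwa [← aeval_inv_reverse_eq_zero_iff (inv_ne_zero (pow_ne_zero _ hξ0)), inv_inv] at h0
  rw [Submodule.mem_bot]
  funext ⟨k, b⟩
  have := congrFun (eq_zero_of_forall_sum_mul_pow_eq_zero hξ
    (fun k => algebraMap F K (a (k, b))) (hvanish b)) k
  simpa using this
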